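/- \textbf{Setting.} Formulas are built from propositional variables $p_0,p_1,\dots$ and $\bot$ by $\to$, $\Box$ and $\Box^+$. A sequent is an expression $\Sigma;\Gamma\Rightarrow\Delta$, where $\Sigma$ is an arbitrary (possibly infinite) set of formulas and $\Gamma,\Delta$ are finite multisets of formulas. For a multiset $\Gamma=A_1,\dots,A_n$ let $\Box\Gamma=\Box A_1,\dots,\Box A_n$ and $\Box^+\Gamma=\Box^+A_1,\dots,\Box^+A_n$. The calculus $\mathsf S$ has the initial sequents $\Sigma;\Gamma,p\Rightarrow p,\Delta$ ($p$ a propositional variable) and $\Sigma;\Gamma,\bot\Rightarrow\Delta$, and the rules $$\frac{\Sigma;\Gamma,B\Rightarrow\Delta\qquad \Sigma;\Gamma\Rightarrow A,\Delta}{\Sigma;\Gamma,A\to B\Rightarrow\Delta}\,(\to_L)\qquad \frac{\Sigma;\Gamma,A\Rightarrow B,\Delta}{\Sigma;\Gamma\Rightarrow A\to B,\Delta}\,(\to_R)$$ $$\frac{\Sigma;\Sigma_0,\Lambda,\Pi,\Box^+\Pi\Rightarrow A}{\Sigma;\Phi,\Box\Lambda,\Box^+\Pi\Rightarrow\Box A,\Psi}\,(\Box)\qquad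 \frac{\Sigma;\Sigma_0,\Lambda,\Pi,\Box^+\Pi\Rightarrow A\qquad \Sigma;\Sigma_0,\Lambda,\Pi,\Box^+\Pi\Rightarrow\Box^+A}{\Sigma;\Phi,\Box\Lambda,\Box^+\Pi\Rightarrow\Box^+A,\Psi}\,(\Box^+)$$ where $\Sigma_0$ is a finite subset of $\Sigma$. The last two rules are the modal rules, with principal formulas $\Box A$ and $\Box^+A$ respectively; an application of a modal rule is slim if neither $\Lambda$ nor $\Pi$ contains repetitions. The calculus $\mathsf S+\mathsf{cut}$ adds the rule $$\frac{\Sigma;\Gamma\Rightarrow A,\Delta\qquad \Sigma;\Gamma,A\Rightarrow\Delta}{\Sigma;\Gamma\Rightarrow\Delta}\,(\mathsf{cut}).$$ An $\infty$-proof is a possibly infinite tree of sequents constructed according to the rules of $\mathsf S+\mathsf{cut}$, in which every leaf is marked by an initial sequent and every infinite branch has a tail such that: (a) all applications of $(\Box^+)$ in the tail have the same principal formula; (b) the tail passes through the right premise of $(\Box^+)$ infinitely many times; (c) the tail does not pass through the left premise of $(\Box^+)$; (d) there are no applications of $(\Box)$ in the tail. An $\infty$-proof is cut-free if it contains no application of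 $(\mathsf{cut})$, and slim if every application of a modal rule in it is slim. A sequent is provable in $\mathsf S+\mathsf{cut}$ if it marks the root of some $\infty$-proof. \textbf{Theorem (cut elimination).} If a sequent $\Sigma;\Gamma\Rightarrow\Delta$ is provable in $\mathsf S+\mathsf{cut}$, then there is an $\infty$-proof of $\Sigma;\Gamma\Rightarrow\Delta$ that is both slim and cut-free. -/

import Mathlib

namespace KPlus

/-- Formulas of the modal logic of transitive closure. -/
inductive Fm : Type
  | var (n : ℕ) : Fm
  | bot : Fm
  | imp (A B : Fm) : Fm
  | box (A : Fm) : Fm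
  | boxPlus (A : Fm) : Fm

/-- Sequents `Sig; ant ⇒ suc`: an arbitrary set of formulas and two finite multisets. -/
@[ext] structure Sequent where
  Sig : Set Fm
  ant : Multiset Fm
  suc : Multiset Fm

/-- Instances of the initial sequents and of the inference rules of the calculus with cut. -/
inductive Inference : Type
  /-- `Sig; Γ, p ⇒ p, Δ` with `p` a propositional variable -/
  | ax (Sig : Set Fm) (Γ Δ : Multiset Fm) (p : ℕ)
  /-- `Sig; Γ, ⊥ ⇒ Δ` -/
  | botL (Sig : Set Fm) (Γ Δ : Multiset Fm)
  /-- from `Sig; Γ, B ⇒ Δ` and `Sig; Γ ⇒ A, Δ` infer `Sig; Γ, A → B ⇒ Δ` -/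
  | impL (Sig : Set Fm) (Γ Δ : Multiset Fm) (A B : Fm)
  /-- from `Sig; Γ, A ⇒ B, Δ` infer `Sig; Γ ⇒ A → B, Δ` -/
  | impR (Sig : Set Fm) (Γ Δ : Multiset Fm) (A B : Fm)
  /-- from `Sig; Sig₀, Λ, P, □⁺P ⇒ A` infer `Sig; Φ, □Λ, □⁺P ⇒ □A, Ψ` -/
  | box (Sig : Set Fm) (Sig₀ : Finset Fm) (hSig : (Sig₀ : Set Fm) ⊆ Sig)
      (Λ P Φ Ψ : Multiset Fm) (A : Fm)
  /-- from `Sig; Sig₀, Λ, P, □⁺P ⇒ A` and `Sig; Sig₀, Λ, P, □⁺P ⇒ □⁺A`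
  infer `Sig; Φ, □Λ, □⁺P ⇒ □⁺A, Ψ` -/
  | boxPlus (Sig : Set Fm) (Sig₀ : Finset Fm) (hSig : (Sig₀ : Set Fm) ⊆ Sig)
      (Λ P Φ Ψ : Multiset Fm) (A : Fm)
  /-- from `Sig; Γ ⇒ A, Δ` and `Sig; Γ, A ⇒ Δ` infer `Sig; Γ ⇒ Δ` -/
  | cut (Sig : Set Fm) (Γ Δ : Multiset Fm) (A : Fm)

namespace Inference

/-- The conclusion of an inference (the sequent itself for an initial sequent). -/
def concl : Inference → Sequent
  | ax Sig Γ Δ p => ⟨Sig, Fm.var p ::ₘ Γ, Fm.var p ::ₘ Δ⟩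
  | botL Sig Γ Δ => ⟨Sig, Fm.bot ::ₘ Γ, Δ⟩
  | impL Sig Γ Δ A B => ⟨Sig, Fm.imp A B ::ₘ Γ, Δ⟩
  | impR Sig Γ Δ A B => ⟨Sig, Γ, Fm.imp A B ::ₘ Δ⟩
  | box Sig _ _ Λ P Φ Ψ A => ⟨Sig, Φ + Λ.map Fm.box + P.map Fm.boxPlus, Fm.box A ::ₘ Ψ⟩
  | boxPlus Sig _ _ Λ P Φ Ψ A =>
      ⟨Sig, Φ + Λ.map Fm.box + P.map Fm.boxPlus, Fm.boxPlus A ::ₘ Ψ⟩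
  | cut Sig Γ Δ _ => ⟨Sig, Γ, Δ⟩

/-- The premises of an inference, from left to right (none for an initial sequent). -/
def premises : Inference → List Sequent
  | ax _ _ _ _ => []
  | botL _ _ _ => []
  | impL Sig Γ Δ A B => [⟨Sig, B ::ₘ Γ, Δ⟩, ⟨Sig, Γ, A ::ₘ Δ⟩]
  | impR Sig Γ Δ A B => [⟨Sig, A ::ₘ Γ, B ::ₘ Δ⟩]
  | box Sig Sig₀ _ Λ P _ _ A => [⟨Sig, Sig₀.val + Λ + P + P.map Fm.boxPlus, {A}⟩]
  | boxPlus Sig Sig₀ _ Λ P _ _ A =>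
      [⟨Sig, Sig₀.val + Λ + P + P.map Fm.boxPlus, {A}⟩,
       ⟨Sig, Sig₀.val + Λ + P + P.map Fm.boxPlus, {Fm.boxPlus A}⟩]
  | cut Sig Γ Δ A => [⟨Sig, Γ, A ::ₘ Δ⟩, ⟨Sig, A ::ₘ Γ, Δ⟩]

/-- The inference is an application of the rule `(□)`. -/
def IsBox : Inference → Prop
  | box _ _ _ _ _ _ _ _ => True
  | _ => False

/-- The inference is an application of the rule `(□⁺)` with principal formula `C`. -/
def IsBoxPlus (C : Fm) : Inference → Prop
  | boxPlus _ _ _ _ _ _ _ A => C = Fm.boxPlus A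
  | _ => False

/-- The inference is an application of the rule `(cut)`. -/
def IsCut : Inference → Prop
  | cut _ _ _ _ => True
  | _ => False

/-- If the inference is an application of a modal rule, then it is slim: the multisets
`Λ` and `P` of its side formulas (with `□`, `□⁺` removed) have no repetitions. -/
def IsSlim : Inference → Prop
  | box _ _ _ Λ P _ _ _ => Λ.Nodup ∧ P.Nodup
  | boxPlus _ _ _ Λ P _ _ _ => Λ.Nodup ∧ P.Nodup
  | _ => True

end Inference

/-- The node at depth `n` on the branch that takes its `k`-th step to premise number `f k`. -/
def branchNode (f : ℕ → ℕ) : ℕ → List ℕ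
  | 0 => []
  | n + 1 => branchNode f n ++ [f n]

/-- Non-well-founded proofs. Nodes are addressed by lists of natural numbers read from the root
`[]`, the `i`-th child of `a` being `a ++ [i]`; `label a = none` means that there is no node
at `a`. Every node carries the inference of which it is the conclusion. -/
structure InfProof where
  label : List ℕ → Option Inference
  root_isSome : (label []).isSome
  /-- The children of a node are marked exactly by the premises of its inference (so leaves are
  marked by initial sequents), and addresses that are not nodes have no children. -/
  step : ∀ (a : List ℕ) (i : ℕ),
    (label (a ++ [i])).map Inference.concl = (label a).bind fun r => r.premises[i]?
  /-- Every infinite branch has a tail (its nodes of depth at least `N`) such that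
  (a) all applications of `(□⁺)` in the tail have the same principal formula `C`;
  (b) the tail passes through the right premise of `(□⁺)` infinitely often;
  (c) the tail does not pass through the left premise of `(□⁺)`;
  (d) there are no applications of `(□)` in the tail. -/
  progress : ∀ f : ℕ → ℕ, (∀ n, (label (branchNode f n)).isSome) →
    ∃ (N : ℕ) (C : Fm),
      (∀ n ≥ N, ∀ r ∈ label (branchNode f n), ∀ D, r.IsBoxPlus D → D = C) ∧
      (∀ m ≥ N, ∃ n ≥ m, ∃ r ∈ label (branchNode f n), (∃ D, r.IsBoxPlus D) ∧ f n = 1) ∧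
      (∀ n ≥ N, ∀ r ∈ label (branchNode f n), (∃ D, r.IsBoxPlus D) → f n ≠ 0) ∧
      (∀ n ≥ N, ∀ r ∈ label (branchNode f n), ¬ r.IsBox)

namespace InfProof

/-- The sequent that marks the root. -/
def root (π : InfProof) : Sequent := ((π.label []).get π.root_isSome).concl

/-- There are no applications of `(cut)`. -/
def CutFree (π : InfProof) : Prop := ∀ a, ∀ r ∈ π.label a, ¬ r.IsCut

/-- All applications of modal rules are slim. -/
def Slim (π : InfProof) : Prop := ∀ a, ∀ r ∈ π.label a, r.IsSlim

end InfProof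

/-- Provability in the calculus with cut. -/
def ProvableWithCut (S : Sequent) : Prop := ∃ π : InfProof, π.root = S

end KPlus

namespace KPlus

open scoped Classical

/-! Cut elimination is proved semantically: slim cut-free provability is complete for a canonical
model in which proofs with cut are sound. Points are saturated pairs of sets of formulas, and a set
of points is necessary at `u` if some modal context applicable at `u` has all its extensions in that
set. `□⁺` is read as the greatest fixed point of `Y ↦ box (X ∩ Y)`.

An underivable sequent extends to a point (`exists_extends`), and `truth_lemma` makes that point
refute it. The hard case is `□⁺A` on the right: if it were true at the point, the fixed point
equation would supply modal contexts again and again, and `derivable_of_coinductive` would assemble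
these into a slim cut-free proof.

Soundness (`not_refutes_root`) is infinite descent. A refuted root yields a branch of refuted
sequents. In the tail of this branch the ordinal rank at which the fixed point approximation drops
the current point never rises, and it falls at each application of `(□⁺)`, of which there are
infinitely many. -/

/-- Number of connectives outside modal subformulas. -/
def Fm.size : Fm → ℕ
  | imp A B => A.size + B.size + 1
  | _ => 0

/-- The total size of the formulas of a sequent. -/
def Sequent.size (S : Sequent) : ℕ := (S.ant.map Fm.size).sum + (S.suc.map Fm.size).sum

/-- Provability by a slim cut-free proof. -/
def Derivable (S : Sequent) : Prop := ∃ π : InfProof, π.root = S ∧ π.Slim ∧ π.CutFree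

theorem InfProof.map_concl_label_nil (π : InfProof) :
    (π.label []).map Inference.concl = some π.root := by
  obtain ⟨r, hr⟩ := Option.isSome_iff_exists.mp π.root_isSome
  simp [InfProof.root, hr]

theorem Inference.IsBoxPlus.eq {r : Inference} {C D : Fm} (hC : r.IsBoxPlus C)
    (hD : r.IsBoxPlus D) : D = C := by
  cases r <;> simp_all [Inference.IsBoxPlus]

theorem Inference.IsBoxPlus.not_isBox {r : Inference} {C : Fm} (hC : r.IsBoxPlus C) :
    ¬ r.IsBox := by
  cases r <;> simp_all [Inference.IsBoxPlus, Inference.IsBox]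

/-! ### Gluing proofs -/

/-- `branchNode` grows at the far end, whereas glued trees are read from the root. -/
theorem branchNode_succ' (f : ℕ → ℕ) (n : ℕ) :
    branchNode f (n + 1) = f 0 :: branchNode (fun k => f (k + 1)) n := by
  induction n with
  | zero => rfl
  | succ n ih => rw [branchNode, ih]; rfl

/-- The tail condition on a branch with inferences `L` that takes its steps according to `f`. -/
def TailCondition (L : ℕ → Option Inference) (f : ℕ → ℕ) : Prop :=
  ∃ (N : ℕ) (C : Fm),
    (∀ n ≥ N, ∀ r ∈ L n, ∀ D, r.IsBoxPlus D → D = C) ∧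
    (∀ m ≥ N, ∃ n ≥ m, ∃ r ∈ L n, (∃ D, r.IsBoxPlus D) ∧ f n = 1) ∧
    (∀ n ≥ N, ∀ r ∈ L n, (∃ D, r.IsBoxPlus D) → f n ≠ 0) ∧
    (∀ n ≥ N, ∀ r ∈ L n, ¬ r.IsBox)

theorem TailCondition.of_shift {L : ℕ → Option Inference} {f : ℕ → ℕ} (k : ℕ)
    (h : TailCondition (fun n => L (n + k)) (fun n => f (n + k))) : TailCondition L f := by
  obtain ⟨N, C, h1, h2, h3, h4⟩ := h
  have key : ∀ n ≥ N + k, n - k ≥ N ∧ n - k + k = n := fun n hn => by omega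
  refine ⟨N + k, C, fun n hn r hr => ?_, fun m hm => ?_, fun n hn r hr => ?_, fun n hn r hr => ?_⟩
  · exact h1 (n - k) (key n hn).1 r (by simpa [(key n hn).2] using hr)
  · obtain ⟨n, hn, r, hr, hD, hf⟩ := h2 (m - k) (key m hm).1
    exact ⟨n + k, by omega, r, hr, hD, hf⟩
  · have := h3 (n - k) (key n hn).1 r (by simpa [(key n hn).2] using hr)
    simpa [(key n hn).2] using this
  · exact h4 (n - k) (key n hn).1 r (by simpa [(key n hn).2] using hr)

/-- Read off a tree from a choice of a last inference for every sequent; whenever a derivable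
sequent is reached, continue with some proof of it. -/
noncomputable def gluedLabel (ρ : Sequent → Inference) : List ℕ → Sequent → Option Inference
  | [], S => if h : Derivable S then h.choose.label [] else some (ρ S)
  | i :: a, S => if h : Derivable S then h.choose.label (i :: a) else
      ((ρ S).premises[i]?).bind (gluedLabel ρ a)

theorem gluedLabel_of_derivable (ρ : Sequent → Inference) {S : Sequent} (h : Derivable S)
    (a : List ℕ) : gluedLabel ρ a S = h.choose.label a := by
  cases a <;> simp [gluedLabel, h]

theorem gluedLabel_nil (ρ : Sequent → Inference) {S : Sequent} (h : ¬ Derivable S) :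
    gluedLabel ρ [] S = some (ρ S) := by
  simp [gluedLabel, h]

theorem gluedLabel_cons (ρ : Sequent → Inference) {S : Sequent} (h : ¬ Derivable S) (i : ℕ)
    (a : List ℕ) :
    gluedLabel ρ (i :: a) S = ((ρ S).premises[i]?).bind (gluedLabel ρ a) := by
  simp [gluedLabel, h]

section Glue

variable {C : Fm} {Z : Set Sequent} {ρ : Sequent → Inference}

theorem map_concl_gluedLabel_nil (hρ : ∀ S ∈ Z, ¬ Derivable S → (ρ S).concl = S) {S : Sequent}
    (hS : Derivable S ∨ S ∈ Z) : (gluedLabel ρ [] S).map Inference.concl = some S := by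
  by_cases h : Derivable S
  · rw [gluedLabel_of_derivable ρ h, InfProof.map_concl_label_nil, h.choose_spec.1]
  · simp [gluedLabel_nil ρ h, hρ S (hS.resolve_left h) h]

theorem gluedLabel_step (hρ : ∀ S ∈ Z, ¬ Derivable S → (ρ S).concl = S)
    (hZ : ∀ S ∈ Z, ¬ Derivable S → ∀ (i : ℕ) (S' : Sequent), (ρ S).premises[i]? = some S' →
      ¬ Derivable S' → S' ∈ Z)
    (i : ℕ) (a : List ℕ) : ∀ S : Sequent, Derivable S ∨ S ∈ Z →
    (gluedLabel ρ (a ++ [i]) S).map Inference.concl =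
      (gluedLabel ρ a S).bind fun r => r.premises[i]? := by
  induction a with
  | nil =>
    intro S hS
    by_cases h : Derivable S
    · simpa only [gluedLabel_of_derivable ρ h] using h.choose.step [] i
    · rw [List.nil_append, gluedLabel_cons ρ h, gluedLabel_nil ρ h]
      rcases hp : (ρ S).premises[i]? with _ | S'
      · simp [hp]
      · simp only [Option.bind_some, hp]
        refine map_concl_gluedLabel_nil hρ ?_
        by_cases h' : Derivable S'
        · exact .inl h'
        · exact .inr (hZ S (hS.resolve_left h) h i S' hp h')
  | cons j a ih =>
    intro S hS
    by_cases h : Derivable S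
    · simpa only [gluedLabel_of_derivable ρ h] using h.choose.step (j :: a) i
    · rw [List.cons_append, gluedLabel_cons ρ h, gluedLabel_cons ρ h]
      rcases hp : (ρ S).premises[j]? with _ | S'
      · simp
      · simp only [Option.bind_some]
        refine ih S' ?_
        by_cases h' : Derivable S'
        · exact .inl h'
        · exact .inr (hZ S (hS.resolve_left h) h j S' hp h')

theorem gluedLabel_forall {p : Inference → Prop}
    (hp : ∀ S (h : Derivable S) a, ∀ r ∈ h.choose.label a, p r)
    (hρ : ∀ S ∈ Z, ¬ Derivable S → p (ρ S))
    (hZ : ∀ S ∈ Z, ¬ Derivable S → ∀ (i : ℕ) (S' : Sequent), (ρ S).premises[i]? = some S' →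
      ¬ Derivable S' → S' ∈ Z)
    (a : List ℕ) : ∀ S : Sequent, Derivable S ∨ S ∈ Z → ∀ r ∈ gluedLabel ρ a S, p r := by
  induction a with
  | nil =>
    intro S hS r hr
    by_cases h : Derivable S
    · exact hp S h [] r (by rwa [gluedLabel_of_derivable ρ h] at hr)
    · rw [gluedLabel_nil ρ h, Option.mem_some_iff] at hr
      exact hr ▸ hρ S (hS.resolve_left h) h
  | cons j a ih =>
    intro S hS r hr
    by_cases h : Derivable S
    · exact hp S h (j :: a) r (by rwa [gluedLabel_of_derivable ρ h] at hr)
    · rw [gluedLabel_cons ρ h] at hr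
      obtain ⟨S', hS', hr⟩ := Option.bind_eq_some_iff.mp hr
      refine ih S' ?_ r hr
      by_cases h' : Derivable S'
      · exact .inl h'
      · exact .inr (hZ S (hS.resolve_left h) h j S' hS' h')

/-- The sequents on a branch of a glued tree, as long as none of them is derivable. -/
noncomputable def gluedBranch (ρ : Sequent → Inference) (f : ℕ → ℕ) (S : Sequent) : ℕ → Sequent
  | 0 => S
  -- The default `S` does not occur while the branch runs through existing nodes and no derivable
  -- sequent has been met.
  | n + 1 => ((ρ (gluedBranch ρ f S n)).premises[f n]?).getD S

/-- Until a derivable sequent is met, the subtree at depth `n` is the glued tree of the `n`-th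
sequent. -/
theorem gluedLabel_branchNode (f : ℕ → ℕ) (S : Sequent)
    (hf : ∀ n, (gluedLabel ρ (branchNode f n) S).isSome) (n : ℕ)
    (h : ∀ k < n, ¬ Derivable (gluedBranch ρ f S k)) (m : ℕ) :
    gluedLabel ρ (branchNode f (m + n)) S =
      gluedLabel ρ (branchNode (fun k => f (k + n)) m) (gluedBranch ρ f S n) := by
  induction n generalizing m with
  | zero => rfl
  | succ n ih =>
    have hn := h n (Nat.lt_succ_self n)
    have key := ih (fun k hk => h k (by omega)) (m + 1)
    rw [branchNode_succ', gluedLabel_cons ρ hn] at key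
    have hs := hf (m + 1 + n)
    rw [key] at hs
    simp only [Nat.zero_add] at hs key
    rcases hp : (ρ (gluedBranch ρ f S n)).premises[f n]? with _ | S'
    · simp [hp] at hs
    · rw [hp, Option.bind_some] at key
      have e : gluedBranch ρ f S (n + 1) = S' := by simp [gluedBranch, hp]
      rw [e, show m + (n + 1) = m + 1 + n by omega, key]
      congr 2
      funext k
      congr 1
      omega

theorem premises_gluedBranch (f : ℕ → ℕ) (S : Sequent)
    (hf : ∀ n, (gluedLabel ρ (branchNode f n) S).isSome)
    (h : ∀ k, ¬ Derivable (gluedBranch ρ f S k)) (n : ℕ) :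
    (ρ (gluedBranch ρ f S n)).premises[f n]? = some (gluedBranch ρ f S (n + 1)) := by
  have hs := hf (0 + 1 + n)
  rw [gluedLabel_branchNode f S hf n (fun k _ => h k), branchNode_succ',
    gluedLabel_cons ρ (h n), Nat.zero_add] at hs
  rcases hp : (ρ (gluedBranch ρ f S n)).premises[f n]? with _ | S'
  · simp [hp] at hs
  · simp [gluedBranch, hp]

/-- Coinduction for slim cut-free provability: proofs may be built corecursively along the right
premises of applications of `(□⁺)` with a fixed principal formula. -/
theorem derivable_of_coinductive (C : Fm) (Z : Set Sequent)
    (hZ : ∀ S ∈ Z, ¬ Derivable S → ∃ r : Inference, r.concl = S ∧ r.IsSlim ∧ ¬ r.IsCut ∧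
      ∀ (i : ℕ) (S' : Sequent), r.premises[i]? = some S' → ¬ Derivable S' → S' ∈ Z ∧
        ((S'.size < S.size ∧ ¬ r.IsBox ∧ ∀ D, ¬ r.IsBoxPlus D) ∨ (r.IsBoxPlus C ∧ i = 1)))
    {S : Sequent} (hS : S ∈ Z) : Derivable S := by
  have : Nonempty Inference := ⟨.botL ∅ 0 0⟩
  choose! ρ hconcl hslim hcut hstep using hZ
  have hmem : ∀ S ∈ Z, ¬ Derivable S → ∀ (i : ℕ) (S' : Sequent),
      (ρ S).premises[i]? = some S' → ¬ Derivable S' → S' ∈ Z :=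
    fun S hS hd i S' h h' => (hstep S hS hd i S' h h').1
  have hroot := map_concl_gluedLabel_nil hconcl (.inr hS)
  obtain ⟨π, hπ⟩ : ∃ π : InfProof, π.label = fun a => gluedLabel ρ a S := by
    refine ⟨⟨fun a => gluedLabel ρ a S, ?_,
      fun a i => gluedLabel_step hconcl hmem i a S (.inr hS), fun f hf => ?_⟩, rfl⟩
    · obtain ⟨r, hr, -⟩ := Option.map_eq_some_iff.mp hroot
      simp [hr]
    · change TailCondition (fun n => gluedLabel ρ (branchNode f n) S) f
      -- A branch that meets a derivable sequent inherits its tail from the proof chosen there;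
      -- otherwise every step obeys `hstep`.
      by_cases hd : ∃ k, Derivable (gluedBranch ρ f S k)
      · have hk := Nat.find_spec hd
        have e := gluedLabel_branchNode f S hf (Nat.find hd) fun k hk => Nat.find_min hd hk
        simp only [gluedLabel_of_derivable ρ hk] at e
        refine .of_shift (Nat.find hd) ?_
        simp only [e]
        exact hk.choose.progress _ fun n => by rw [← e]; exact hf _
      · push Not at hd
        have e : ∀ n, gluedLabel ρ (branchNode f n) S = some (ρ (gluedBranch ρ f S n)) := by
          intro n
          have := gluedLabel_branchNode f S hf n (fun k _ => hd k) 0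
          rwa [Nat.zero_add, branchNode, gluedLabel_nil ρ (hd n)] at this
        have hp := premises_gluedBranch f S hf hd
        have hin : ∀ n, gluedBranch ρ f S n ∈ Z := by
          intro n
          induction n with
          | zero => exact hS
          | succ n ih => exact hmem _ ih (hd n) _ _ (hp n) (hd _)
        have hst := fun n => (hstep _ (hin n) (hd n) _ _ (hp n) (hd _)).2
        refine ⟨0, C, fun n _ r hr D hD => ?_, fun m _ => ?_, fun n _ r hr hD => ?_,
          fun n _ r hr => ?_⟩
        · simp only [e, Option.mem_some_iff] at hr
          subst hr
          rcases hst n with h | h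
          · exact (h.2.2 D hD).elim
          · exact h.1.eq hD
        -- If right premises of `(□⁺)` stopped occurring, the size would decrease forever.
        · by_contra hno
          push Not at hno
          have hlt : ∀ n ≥ m, (gluedBranch ρ f S (n + 1)).size < (gluedBranch ρ f S n).size := by
            intro n hn
            rcases hst n with h | h
            · exact h.1
            · exact (hno n hn _ (e n) ⟨C, h.1⟩ h.2).elim
          have hle : ∀ k, (gluedBranch ρ f S (m + k)).size + k ≤ (gluedBranch ρ f S m).size := by
            intro k
            induction k with
            | zero => simp
            | succ k ih =>
              have := hlt (m + k) (by omega)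
              rw [add_assoc] at this
              omega
          have := hle ((gluedBranch ρ f S m).size + 1)
          omega
        · simp only [e, Option.mem_some_iff] at hr
          subst hr
          obtain ⟨D, hD⟩ := hD
          rcases hst n with h | h
          · exact (h.2.2 D hD).elim
          · simp [h.2]
        · simp only [e, Option.mem_some_iff] at hr
          subst hr
          rcases hst n with h | h
          · exact h.2.1
          · exact h.1.not_isBox
  refine ⟨π, ?_, fun a => ?_, fun a => ?_⟩
  · refine Option.some_injective _ (π.map_concl_label_nil.symm.trans ?_)
    rw [hπ, hroot]
  · rw [hπ]
    exact gluedLabel_forall (fun S h => h.choose_spec.2.1) hslim hmem a S (.inr hS)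
  · rw [hπ]
    exact gluedLabel_forall (fun S h => h.choose_spec.2.2) hcut hmem a S (.inr hS)

end Glue

/-- Coinduction with a singleton: no premise is underivable, so the principal formula `Fm.bot` is a
dummy. -/
theorem derivable_concl {r : Inference} (hs : r.IsSlim) (hc : ¬ r.IsCut)
    (h : ∀ S ∈ r.premises, Derivable S) : Derivable r.concl := by
  refine derivable_of_coinductive Fm.bot {r.concl} ?_ rfl
  rintro S rfl -
  exact ⟨r, rfl, hs, hc, fun i S' hi hn => (hn (h S' (List.mem_of_getElem? hi))).elim⟩

/-! ### Modal contexts -/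

/-- The data that an application of a modal rule selects from `Sig` and from the antecedent. -/
structure ModalContext (Sig : Set Fm) where
  base : Finset Fm
  boxes : Finset Fm
  pluses : Finset Fm
  base_subset : (base : Set Fm) ⊆ Sig

namespace ModalContext

variable {Sig : Set Fm}

/-- The antecedent of the premises of a modal rule. -/
def ant (d : ModalContext Sig) : Multiset Fm :=
  d.base.val + d.boxes.val + d.pluses.val + d.pluses.val.map Fm.boxPlus

/-- The formulas in `U` permit the use of the modal context. -/
def Applies (d : ModalContext Sig) (U : Set Fm) : Prop :=
  (∀ A ∈ d.boxes, Fm.box A ∈ U) ∧ ∀ A ∈ d.pluses, Fm.boxPlus A ∈ U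

/-- A repetition-free multiset contained in `Γ` as a set is a submultiset of `Γ`. Taking finsets in
modal contexts thus also secures slimness. -/
theorem Applies.exists_eq_add {d : ModalContext Sig} {Γ : Multiset Fm}
    (h : d.Applies {A | A ∈ Γ}) :
    ∃ Φ, Γ = Φ + d.boxes.val.map Fm.box + d.pluses.val.map Fm.boxPlus := by
  have hle : d.boxes.val.map Fm.box + d.pluses.val.map Fm.boxPlus ≤ Γ := by
    rw [Multiset.le_iff_subset]
    · intro A hA
      rcases Multiset.mem_add.mp hA with hA | hA <;>
        obtain ⟨B, hB, rfl⟩ := Multiset.mem_map.mp hA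
      · exact h.1 B hB
      · exact h.2 B hB
    · rw [Multiset.nodup_add]
      refine ⟨d.boxes.nodup.map fun _ _ => Fm.box.inj,
        d.pluses.nodup.map fun _ _ => Fm.boxPlus.inj, ?_⟩
      rw [Multiset.disjoint_left]
      intro A hA hA'
      obtain ⟨B, -, rfl⟩ := Multiset.mem_map.mp hA
      obtain ⟨B', -, h'⟩ := Multiset.mem_map.mp hA'
      cases h'
  obtain ⟨Φ, hΦ⟩ := Multiset.le_iff_exists_add.mp hle
  exact ⟨Φ, by rw [hΦ, add_comm, add_assoc]⟩

theorem Applies.derivable_box {d : ModalContext Sig} {Γ Δ : Multiset Fm} {A : Fm}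
    (h : d.Applies {A | A ∈ Γ}) (hA : Fm.box A ∈ Δ) (hd : Derivable ⟨Sig, d.ant, {A}⟩) :
    Derivable ⟨Sig, Γ, Δ⟩ := by
  obtain ⟨Φ, rfl⟩ := h.exists_eq_add
  obtain ⟨Ψ, rfl⟩ := Multiset.exists_cons_of_mem hA
  refine derivable_concl (r := .box Sig d.base d.base_subset d.boxes.val d.pluses.val Φ Ψ A)
    ⟨d.boxes.nodup, d.pluses.nodup⟩ id ?_
  simpa [Inference.premises, ModalContext.ant] using hd

/-- The application of `(□⁺)` with a given modal context. -/
theorem Applies.exists_boxPlus {d : ModalContext Sig} {Γ Δ : Multiset Fm} {A : Fm}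
    (h : d.Applies {A | A ∈ Γ}) (hA : Fm.boxPlus A ∈ Δ) :
    ∃ r : Inference, r.concl = ⟨Sig, Γ, Δ⟩ ∧ r.IsSlim ∧ ¬ r.IsCut ∧ r.IsBoxPlus (Fm.boxPlus A) ∧
      r.premises = [⟨Sig, d.ant, {A}⟩, ⟨Sig, d.ant, {Fm.boxPlus A}⟩] := by
  obtain ⟨Φ, rfl⟩ := h.exists_eq_add
  obtain ⟨Ψ, rfl⟩ := Multiset.exists_cons_of_mem hA
  exact ⟨.boxPlus Sig d.base d.base_subset d.boxes.val d.pluses.val Φ Ψ A, rfl,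
    ⟨d.boxes.nodup, d.pluses.nodup⟩, id, rfl, rfl⟩

end ModalContext

/-! ### Points of the canonical model -/

/-- Points of the canonical model: downward saturated pairs of sets of formulas to which no
modal rule with derivable premises applies. -/
structure Point (Sig : Set Fm) where
  pos : Set Fm
  neg : Set Fm
  var_notMem : ∀ p, Fm.var p ∈ pos → Fm.var p ∉ neg
  bot_notMem : Fm.bot ∉ pos
  imp_pos : ∀ A B, Fm.imp A B ∈ pos → B ∈ pos ∨ A ∈ neg
  imp_neg : ∀ A B, Fm.imp A B ∈ neg → A ∈ pos ∧ B ∈ neg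
  box_neg : ∀ A, Fm.box A ∈ neg → ∀ d : ModalContext Sig, d.Applies pos →
    ¬ Derivable ⟨Sig, d.ant, {A}⟩
  boxPlus_neg : ∀ A, Fm.boxPlus A ∈ neg → ∀ d : ModalContext Sig, d.Applies pos →
    Derivable ⟨Sig, d.ant, {A}⟩ → ¬ Derivable ⟨Sig, d.ant, {Fm.boxPlus A}⟩

namespace Point

variable {Sig : Set Fm}

/-- Modal contexts inspect only boxed formulas, so implications can be added to a point without
creating new applicable contexts. -/
theorem applies_insert_imp {d : ModalContext Sig} {U : Set Fm} {A B : Fm} :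
    d.Applies (insert (Fm.imp A B) U) ↔ d.Applies U := by
  simp [ModalContext.Applies]

/-- Add an implication to the left component of a point. -/
def insertPos (u : Point Sig) (A B : Fm) (h : B ∈ u.pos ∨ A ∈ u.neg) : Point Sig where
  pos := insert (Fm.imp A B) u.pos
  neg := u.neg
  var_notMem p hp := u.var_notMem p (by simpa using hp)
  bot_notMem := by simpa using u.bot_notMem
  imp_pos A' B' h' := by
    rcases h' with h' | h'
    · cases h'
      exact h.imp_left (Set.mem_insert_of_mem _)
    · exact (u.imp_pos A' B' h').imp_left (Set.mem_insert_of_mem _)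
  imp_neg A' B' h' := (u.imp_neg A' B' h').imp_left (Set.mem_insert_of_mem _)
  box_neg A' h' d hd := u.box_neg A' h' d (applies_insert_imp.mp hd)
  boxPlus_neg A' h' d hd := u.boxPlus_neg A' h' d (applies_insert_imp.mp hd)

/-- Add an implication to the right component of a point. -/
def insertNeg (u : Point Sig) (A B : Fm) (h : A ∈ u.pos ∧ B ∈ u.neg) : Point Sig where
  pos := u.pos
  neg := insert (Fm.imp A B) u.neg
  var_notMem p hp := by simpa using u.var_notMem p hp
  bot_notMem := u.bot_notMem
  imp_pos A' B' h' := (u.imp_pos A' B' h').imp_right (Set.mem_insert_of_mem _)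
  imp_neg A' B' h' := by
    rcases h' with h' | h'
    · cases h'
      exact h.imp_right (Set.mem_insert_of_mem _)
    · exact (u.imp_neg A' B' h').imp_right (Set.mem_insert_of_mem _)
  box_neg A' h' d hd := u.box_neg A' (by simpa using h') d hd
  boxPlus_neg A' h' d hd := u.boxPlus_neg A' (by simpa using h') d hd

/-- The point extends the sequent with antecedent `Γ` and succedent `Δ`. -/
def Extends (u : Point Sig) (Γ Δ : Multiset Fm) : Prop :=
  (∀ A ∈ Γ, A ∈ u.pos) ∧ ∀ A ∈ Δ, A ∈ u.neg

/-- An underivable sequent without implications is itself a point. -/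
theorem exists_of_saturated {Γ Δ : Multiset Fm} (h : ¬ Derivable ⟨Sig, Γ, Δ⟩)
    (hΓ : ∀ A B, Fm.imp A B ∉ Γ) (hΔ : ∀ A B, Fm.imp A B ∉ Δ) :
    ∃ u : Point Sig, u.pos = {A | A ∈ Γ} ∧ u.neg = {A | A ∈ Δ} := by
  refine ⟨⟨{A | A ∈ Γ}, {A | A ∈ Δ}, fun p hp hp' => h ?_, fun hb => h ?_,
    fun A B h' => (hΓ A B h').elim, fun A B h' => (hΔ A B h').elim,
    fun A hA d hd hd' => h (hd.derivable_box hA hd'), fun A hA d hd h1 h2 => h ?_⟩, rfl, rfl⟩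
  · obtain ⟨Γ, rfl⟩ := Multiset.exists_cons_of_mem hp
    obtain ⟨Δ, rfl⟩ := Multiset.exists_cons_of_mem hp'
    exact derivable_concl (r := .ax Sig Γ Δ p) trivial id (by simp [Inference.premises])
  · obtain ⟨Γ, rfl⟩ := Multiset.exists_cons_of_mem hb
    exact derivable_concl (r := .botL Sig Γ Δ) trivial id (by simp [Inference.premises])
  · obtain ⟨r, hr, hs, hc, -, hp⟩ := hd.exists_boxPlus hA
    rw [← hr]
    exact derivable_concl hs hc (by simp [hp, h1, h2])

/-- Backward proof search through implications: some premise stays underivable, and the decomposed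
implication is put back into the point obtained for it. -/
theorem exists_extends {Γ Δ : Multiset Fm} (h : ¬ Derivable ⟨Sig, Γ, Δ⟩) :
    ∃ u : Point Sig, u.Extends Γ Δ := by
  induction hn : (⟨Sig, Γ, Δ⟩ : Sequent).size using Nat.strong_induction_on generalizing Γ Δ with
  | _ n ih =>
    subst hn
    by_cases hΓ : ∃ A B, Fm.imp A B ∈ Γ
    · obtain ⟨A, B, hAB⟩ := hΓ
      obtain ⟨Γ, rfl⟩ := Multiset.exists_cons_of_mem hAB
      by_cases h1 : Derivable ⟨Sig, B ::ₘ Γ, Δ⟩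
      · have h2 : ¬ Derivable ⟨Sig, Γ, A ::ₘ Δ⟩ := fun h2 => h <|
          derivable_concl (r := .impL Sig Γ Δ A B) trivial id (by simp [Inference.premises, h1, h2])
        obtain ⟨u, hu, hu'⟩ := ih _ (by simp [Sequent.size, Fm.size]; omega) h2 rfl
        refine ⟨u.insertPos A B (.inr (hu' A (by simp))), ?_, fun D hD => hu' D (by simp [hD])⟩
        intro D hD
        exact (Multiset.mem_cons.mp hD).imp id (hu D)
      · obtain ⟨u, hu, hu'⟩ := ih _ (by simp [Sequent.size, Fm.size]) h1 rfl
        refine ⟨u.insertPos A B (.inl (hu B (by simp))), ?_, hu'⟩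
        intro D hD
        exact (Multiset.mem_cons.mp hD).imp id fun hD => hu D (by simp [hD])
    by_cases hΔ : ∃ A B, Fm.imp A B ∈ Δ
    · obtain ⟨A, B, hAB⟩ := hΔ
      obtain ⟨Δ, rfl⟩ := Multiset.exists_cons_of_mem hAB
      have h1 : ¬ Derivable ⟨Sig, A ::ₘ Γ, B ::ₘ Δ⟩ := fun h1 => h <|
        derivable_concl (r := .impR Sig Γ Δ A B) trivial id (by simp [Inference.premises, h1])
      obtain ⟨u, hu, hu'⟩ := ih _ (by simp [Sequent.size, Fm.size]; omega) h1 rfl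
      refine ⟨u.insertNeg A B ⟨hu A (by simp), hu' B (by simp)⟩, fun D hD => hu D (by simp [hD]), ?_⟩
      intro D hD
      exact (Multiset.mem_cons.mp hD).imp id fun hD => hu' D (by simp [hD])
    push Not at hΓ hΔ
    obtain ⟨u, hu, hu'⟩ := exists_of_saturated h hΓ hΔ
    exact ⟨u, by simp [hu], by simp [hu']⟩

/-! ### Truth in the canonical model -/

/-- The neighbourhood modality of the canonical model. -/
def box (X : Set (Point Sig)) : Set (Point Sig) :=
  {u | ∃ d : ModalContext Sig, d.Applies u.pos ∧ ∀ v : Point Sig, (∀ A ∈ d.ant, A ∈ v.pos) → v ∈ X}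

theorem box_mono {X Y : Set (Point Sig)} (h : X ⊆ Y) : box X ⊆ box Y :=
  fun _ ⟨d, hd, hX⟩ => ⟨d, hd, fun v hv => h (hX v hv)⟩

theorem mem_box_univ (u : Point Sig) : u ∈ box Set.univ :=
  ⟨⟨∅, ∅, ∅, by simp⟩, by simp [ModalContext.Applies], fun _ _ => trivial⟩

/-- Two contexts merge into their union; finset union absorbs the contraction. -/
theorem mem_box_inter {u : Point Sig} {X Y : Set (Point Sig)} (hX : u ∈ box X) (hY : u ∈ box Y) :
    u ∈ box (X ∩ Y) := by
  obtain ⟨d, ⟨hd, hd'⟩, hX⟩ := hX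
  obtain ⟨e, ⟨he, he'⟩, hY⟩ := hY
  refine ⟨⟨d.base ∪ e.base, d.boxes ∪ e.boxes, d.pluses ∪ e.pluses, ?_⟩, ⟨?_, ?_⟩, fun v hv =>
    ⟨hX v fun A hA => hv A ?_, hY v fun A hA => hv A ?_⟩⟩
  · simpa using ⟨d.base_subset, e.base_subset⟩
  · intro A hA
    exact (Finset.mem_union.mp hA).elim (hd A) (he A)
  · intro A hA
    exact (Finset.mem_union.mp hA).elim (hd' A) (he' A)
  · simp only [ModalContext.ant, Multiset.mem_add, Multiset.mem_map, Finset.mem_val,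
      Finset.mem_union] at hA ⊢
    grind
  · simp only [ModalContext.ant, Multiset.mem_add, Multiset.mem_map, Finset.mem_val,
      Finset.mem_union] at hA ⊢
    grind

theorem mem_box_forall {ι : Type*} {u : Point Sig} (X : ι → Set (Point Sig)) (M : Multiset ι)
    (h : ∀ i ∈ M, u ∈ box (X i)) : u ∈ box {v | ∀ i ∈ M, v ∈ X i} := by
  induction M using Multiset.induction with
  | empty => simpa using mem_box_univ u
  | cons i M ih =>
    refine box_mono ?_ (mem_box_inter (h i (by simp)) (ih fun j hj => h j (by simp [hj])))
    rintro v ⟨h1, h2⟩ j hj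
    rcases Multiset.mem_cons.mp hj with rfl | hj
    · exact h1
    · exact h2 j hj

/-- Ordinal approximations from above of the greatest fixed point of `Y ↦ box (X ∩ Y)`. -/
def stage (X : Set (Point Sig)) (α : Ordinal.{0}) : Set (Point Sig) :=
  box (X ∩ {v | ∀ β, (_ : β < α) → v ∈ stage X β})
termination_by α

/-- The transitive closure modality of the canonical model. -/
def boxPlus (X : Set (Point Sig)) : Set (Point Sig) := {u | ∀ α, u ∈ stage X α}

/-- The first approximation of `boxPlus X` that omits a point. -/
noncomputable def rank (X : Set (Point Sig)) (u : Point Sig) : Ordinal.{0} :=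
  sInf {α | u ∉ stage X α}

theorem notMem_stage_rank {X : Set (Point Sig)} {u : Point Sig} (h : u ∉ boxPlus X) :
    u ∉ stage X (rank X u) := by
  have : {α | u ∉ stage X α}.Nonempty := by simpa [boxPlus, Set.Nonempty] using h
  exact csInf_mem this

theorem rank_le {X : Set (Point Sig)} {u : Point Sig} {α : Ordinal} (h : u ∉ stage X α) :
    rank X u ≤ α :=
  csInf_le' h

theorem boxPlus_subset (X : Set (Point Sig)) : boxPlus X ⊆ box (X ∩ boxPlus X) := by
  intro u hu
  -- This ordinal exceeds every rank, so each point outside `boxPlus X` is already missing from an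
  -- earlier stage.
  have h := hu (Order.succ (⨆ v : Point Sig, rank X v))
  rw [stage] at h
  refine box_mono (Set.inter_subset_inter_right _ fun v hv => ?_) h
  by_contra hv'
  exact notMem_stage_rank hv'
    (hv _ (Order.lt_succ_of_le (le_ciSup (Ordinal.bddAbove_of_small (s := Set.range _)) v)))

/-- Every post-fixed point lies below all stages; with `boxPlus_subset`, this makes `boxPlus X` the
greatest fixed point. -/
theorem subset_boxPlus {X Y : Set (Point Sig)} (h : Y ⊆ box (X ∩ Y)) : Y ⊆ boxPlus X := by
  intro u hu α
  induction α using WellFoundedLT.induction generalizing u with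
  | _ α ih =>
    rw [stage]
    exact box_mono (Set.inter_subset_inter_right _ fun v hv β hβ => ih β hβ hv) (h hu)

/-- The set of points at which a formula is true. -/
def truth (Sig : Set Fm) : Fm → Set (Point Sig)
  | .var p => {u | Fm.var p ∈ u.pos}
  | .bot => ∅
  | .imp A B => {u | u ∈ truth Sig A → u ∈ truth Sig B}
  | .box A => box (truth Sig A)
  | .boxPlus A => boxPlus (truth Sig A)

theorem derivable_of_forall_mem {X : Set (Point Sig)} {Γ : Multiset Fm} {A : Fm}
    (hA : ∀ u ∈ X, A ∉ u.neg) (h : ∀ u : Point Sig, (∀ B ∈ Γ, B ∈ u.pos) → u ∈ X) :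
    Derivable ⟨Sig, Γ, {A}⟩ := by
  by_contra hn
  obtain ⟨u, hu, hu'⟩ := exists_extends hn
  exact hA u (h u hu) (hu' A (by simp))

/-- If all points extending a sequent with `□⁺A` on the right validate `□⁺A` semantically, then
the sequent is derivable. -/
theorem derivable_of_forall_mem_boxPlus {X : Set (Point Sig)} {A : Fm}
    (hA : ∀ u ∈ X, A ∉ u.neg) {Γ Δ : Multiset Fm} (hΔ : Fm.boxPlus A ∈ Δ)
    (h : ∀ u : Point Sig, u.Extends Γ Δ → u ∈ box (X ∩ boxPlus X)) :
    Derivable ⟨Sig, Γ, Δ⟩ := by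
  refine derivable_of_coinductive (Fm.boxPlus A) {S | S.Sig = Sig ∧ Fm.boxPlus A ∈ S.suc ∧
    ∀ u : Point Sig, u.Extends S.ant S.suc → u ∈ box (X ∩ boxPlus X)} ?_ ⟨rfl, hΔ, h⟩
  clear h hΔ Γ Δ
  rintro ⟨Sig', Γ, Δ⟩ ⟨rfl, hΔ, h⟩ hn
  simp only at hΔ h hn
  by_cases hiΓ : ∃ A B, Fm.imp A B ∈ Γ
  · obtain ⟨D, E, hDE⟩ := hiΓ
    obtain ⟨Γ, rfl⟩ := Multiset.exists_cons_of_mem hDE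
    refine ⟨.impL _ Γ Δ D E, rfl, trivial, id, fun i S' hi _ => ?_⟩
    have key : S' = ⟨Sig', E ::ₘ Γ, Δ⟩ ∨ S' = ⟨Sig', Γ, D ::ₘ Δ⟩ := by
      simpa [Inference.premises] using List.mem_of_getElem? hi
    rcases key with rfl | rfl
    · refine ⟨⟨rfl, hΔ, fun u hu => ?_⟩, .inl ⟨?_, id, fun _ => id⟩⟩
      -- The enlarged point extends the conclusion, and the context it yields already applies at
      -- `u`.
      · obtain ⟨d, hd, hd'⟩ := h (u.insertPos D E (.inl (hu.1 E (by simp)))) ⟨fun B hB =>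
          (Multiset.mem_cons.mp hB).imp id fun hB => hu.1 B (by simp [hB]), hu.2⟩
        exact ⟨d, applies_insert_imp.mp hd, hd'⟩
      · simp [Sequent.size, Fm.size]
    · refine ⟨⟨rfl, by simp [hΔ], fun u hu => ?_⟩, .inl ⟨?_, id, fun _ => id⟩⟩
      · obtain ⟨d, hd, hd'⟩ := h (u.insertPos D E (.inr (hu.2 D (by simp)))) ⟨fun B hB =>
          (Multiset.mem_cons.mp hB).imp id (hu.1 B), fun B hB => hu.2 B (by simp [hB])⟩
        exact ⟨d, applies_insert_imp.mp hd, hd'⟩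
      · simp [Sequent.size, Fm.size]; omega
  by_cases hiΔ : ∃ A B, Fm.imp A B ∈ Δ
  · obtain ⟨D, E, hDE⟩ := hiΔ
    obtain ⟨Δ, rfl⟩ := Multiset.exists_cons_of_mem hDE
    have hΔ' : Fm.boxPlus A ∈ Δ := by simpa using hΔ
    refine ⟨.impR _ Γ Δ D E, rfl, trivial, id, fun i S' hi _ => ?_⟩
    obtain rfl : S' = ⟨Sig', D ::ₘ Γ, E ::ₘ Δ⟩ := by
      simpa [Inference.premises] using List.mem_of_getElem? hi
    refine ⟨⟨rfl, by simp [hΔ'], fun u hu => ?_⟩, .inl ⟨?_, id, fun _ => id⟩⟩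
    · exact h (u.insertNeg D E ⟨hu.1 D (by simp), hu.2 E (by simp)⟩)
        ⟨fun B hB => hu.1 B (by simp [hB]), fun B hB =>
          (Multiset.mem_cons.mp hB).imp id fun hB => hu.2 B (by simp [hB])⟩
    · simp [Sequent.size, Fm.size]; omega
  push Not at hiΓ hiΔ
  -- Without implications the sequent is itself a point, and the context witnessing `box` there
  -- dictates the application of `(□⁺)`. Its left premise is derivable by completeness; its right
  -- premise satisfies the invariant again.
  obtain ⟨u, hu, hu'⟩ := exists_of_saturated hn hiΓ hiΔ
  obtain ⟨d, hd, hX⟩ := h u ⟨by simp [hu], by simp [hu']⟩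
  rw [hu] at hd
  obtain ⟨r, hr, hs, hc, hC, hp⟩ := hd.exists_boxPlus hΔ
  refine ⟨r, hr, hs, hc, fun i S' hi hn' => ?_⟩
  rw [hp] at hi
  rcases i with _ | _ | i
  · obtain rfl : (⟨Sig', d.ant, {A}⟩ : Sequent) = S' := by simpa using hi
    exact (hn' (derivable_of_forall_mem hA fun v hv => (hX v hv).1)).elim
  · obtain rfl : (⟨Sig', d.ant, {Fm.boxPlus A}⟩ : Sequent) = S' := by simpa using hi
    exact ⟨⟨rfl, by simp, fun v hv => boxPlus_subset X (hX v hv.1).2⟩, .inr ⟨hC, rfl⟩⟩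
  · simp at hi

/-- Only one direction is claimed for each component: a formula may belong to neither, which is what
allows points to be built without cut. -/
theorem truth_lemma (A : Fm) :
    ∀ u : Point Sig, (A ∈ u.pos → u ∈ truth Sig A) ∧ (A ∈ u.neg → u ∉ truth Sig A) := by
  induction A with
  | var p => exact fun u => ⟨id, fun h h' => u.var_notMem p h' h⟩
  | bot => exact fun u => ⟨fun h => (u.bot_notMem h).elim, fun _ => id⟩
  | imp A B ihA ihB =>
    refine fun u => ⟨fun h hA => ?_, fun h h' => ?_⟩
    · rcases u.imp_pos A B h with h | h
      · exact (ihB u).1 h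
      · exact ((ihA u).2 h hA).elim
    · obtain ⟨h1, h2⟩ := u.imp_neg A B h
      exact (ihB u).2 h2 (h' ((ihA u).1 h1))
  | box A ih =>
    refine fun u => ⟨fun h => ?_, fun h ⟨d, hd, hX⟩ => ?_⟩
    · exact ⟨⟨∅, {A}, ∅, by simp⟩, by simpa [ModalContext.Applies] using h,
        fun v hv => (ih v).1 (hv A (by simp [ModalContext.ant]))⟩
    · exact u.box_neg A h d hd (derivable_of_forall_mem (fun v hv hA => (ih v).2 hA hv) hX)
  | boxPlus A ih =>
    refine fun u => ⟨fun h => ?_, fun h h' => ?_⟩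
    -- The points with `□⁺A` on the left form a post-fixed point, witnessed by the context whose
    -- only formula is `A`, taken from `□⁺A`.
    · refine subset_boxPlus (Y := {v | Fm.boxPlus A ∈ v.pos}) (fun v hv => ?_) h
      exact ⟨⟨∅, ∅, {A}, by simp⟩, by simpa [ModalContext.Applies] using hv, fun w hw =>
        ⟨(ih w).1 (hw A (by simp [ModalContext.ant])), hw _ (by simp [ModalContext.ant])⟩⟩
    · obtain ⟨d, hd, hX⟩ := boxPlus_subset _ h'
      have hA : ∀ v ∈ truth Sig A, A ∉ v.neg := fun v hv hA => (ih v).2 hA hv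
      exact u.boxPlus_neg A h d hd (derivable_of_forall_mem hA fun v hv => (hX v hv).1)
        (derivable_of_forall_mem_boxPlus hA (by simp) fun v hv => boxPlus_subset _ (hX v hv.1).2)

theorem mem_box_truth_of_mem {A : Fm} (hA : A ∈ Sig) (u : Point Sig) : u ∈ box (truth Sig A) :=
  ⟨⟨{A}, ∅, ∅, by simpa using hA⟩, by simp [ModalContext.Applies],
    fun v hv => (truth_lemma A v).1 (hv A (by simp [ModalContext.ant]))⟩

/-! ### Soundness of proofs with cut -/

/-- The point refutes the sequent. -/
def Refutes (u : Point Sig) (S : Sequent) : Prop :=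
  S.Sig = Sig ∧ (∀ A ∈ S.ant, u ∈ truth Sig A) ∧ ∀ A ∈ S.suc, u ∉ truth Sig A

theorem mem_box_premise {u : Point Sig} {Sig₀ : Finset Fm} (hSig : (Sig₀ : Set Fm) ⊆ Sig)
    {Λ P Φ : Multiset Fm}
    (h : ∀ A ∈ Φ + Λ.map Fm.box + P.map Fm.boxPlus, u ∈ truth Sig A) :
    u ∈ box {v | ∀ A ∈ Sig₀.val + Λ + P + P.map Fm.boxPlus, v ∈ truth Sig A} := by
  refine mem_box_forall _ _ fun A hA => ?_
  simp only [Multiset.mem_add] at hA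
  have hplus : ∀ B ∈ P, u ∈ box (truth Sig B ∩ boxPlus (truth Sig B)) := fun B hB =>
    boxPlus_subset _ (h (Fm.boxPlus B) (by simp [hB]))
  rcases hA with ((hA | hA) | hA) | hA
  · exact mem_box_truth_of_mem (hSig hA) u
  · exact h (Fm.box A) (by simp [hA])
  · exact box_mono Set.inter_subset_left (hplus A hA)
  · obtain ⟨B, hB, rfl⟩ := Multiset.mem_map.mp hA
    exact box_mono Set.inter_subset_right (hplus B hB)

/-- Local soundness, recording what the descent needs: the point changes only at modal rules, and at
the right premise of `(□⁺)` the rank falls. -/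
theorem exists_refutes_premise {u : Point Sig} {r : Inference} (h : u.Refutes r.concl) :
    ∃ (i : ℕ) (v : Point Sig) (S : Sequent), r.premises[i]? = some S ∧ v.Refutes S ∧
      ((v = u ∧ ∀ D, ¬ r.IsBoxPlus D) ∨ r.IsBox ∨ (∃ D, r.IsBoxPlus D) ∧ i = 0 ∨
        ∃ A, r.IsBoxPlus (Fm.boxPlus A) ∧ rank (truth Sig A) v < rank (truth Sig A) u) := by
  cases r with
  | ax Sig' Γ Δ p =>
    exact (h.2.2 (Fm.var p) (by simp [Inference.concl])
      (h.2.1 (Fm.var p) (by simp [Inference.concl]))).elim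
  | botL Sig' Γ Δ => exact (h.2.1 Fm.bot (by simp [Inference.concl])).elim
  | impL Sig' Γ Δ A B =>
    obtain ⟨h0, h1, h2⟩ := h
    simp only [Inference.concl, Multiset.forall_mem_cons] at h0 h1 h2
    by_cases hA : u ∈ truth Sig A
    · exact ⟨0, u, _, rfl, ⟨h0, by simpa using ⟨h1.1 hA, h1.2⟩, h2⟩, .inl ⟨rfl, fun _ => id⟩⟩
    · exact ⟨1, u, _, rfl, ⟨h0, h1.2, by simpa using ⟨hA, h2⟩⟩, .inl ⟨rfl, fun _ => id⟩⟩
  | impR Sig' Γ Δ A B =>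
    obtain ⟨h0, h1, h2⟩ := h
    simp only [Inference.concl, Multiset.forall_mem_cons] at h0 h1 h2
    have := Classical.not_imp.mp h2.1
    exact ⟨0, u, _, rfl, ⟨h0, by simpa using ⟨this.1, h1⟩, by simpa using ⟨this.2, h2.2⟩⟩, .inl ⟨rfl, fun _ => id⟩⟩
  | cut Sig' Γ Δ A =>
    obtain ⟨h0, h1, h2⟩ := h
    simp only [Inference.concl] at h0 h1 h2
    -- Cut is sound because truth is two-valued, even for formulas in neither component of `u`.
    by_cases hA : u ∈ truth Sig A
    · exact ⟨1, u, _, rfl, ⟨h0, by simpa using ⟨hA, h1⟩, h2⟩, .inl ⟨rfl, fun _ => id⟩⟩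
    · exact ⟨0, u, _, rfl, ⟨h0, h1, by simpa using ⟨hA, h2⟩⟩, .inl ⟨rfl, fun _ => id⟩⟩
  | box Sig' Sig₀ hSig Λ P Φ Ψ A =>
    obtain ⟨h0, h1, h2⟩ := h
    simp only [Inference.concl] at h0 h1 h2
    subst h0
    obtain ⟨d, hd, hv⟩ := mem_box_premise hSig h1
    have hA : u ∉ box (truth Sig' A) := h2 (Fm.box A) (by simp)
    obtain ⟨v, hv', hvA⟩ : ∃ v : Point Sig', (∀ B ∈ d.ant, B ∈ v.pos) ∧ v ∉ truth Sig' A := by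
      by_contra! hc
      exact hA ⟨d, hd, hc⟩
    exact ⟨0, v, _, rfl, ⟨rfl, hv v hv', by simpa using hvA⟩, .inr (.inl trivial)⟩
  | boxPlus Sig' Sig₀ hSig Λ P Φ Ψ A =>
    obtain ⟨h0, h1, h2⟩ := h
    simp only [Inference.concl] at h0 h1 h2
    subst h0
    obtain ⟨d, hd, hv⟩ := mem_box_premise hSig h1
    have hA := notMem_stage_rank (h2 (Fm.boxPlus A) (by simp))
    rw [stage] at hA
    -- Unfolding the stage that omits `u` gives a point that falsifies `A` or is missing from an
    -- earlier stage.
    obtain ⟨v, hv', hvA⟩ : ∃ v : Point Sig', (∀ B ∈ d.ant, B ∈ v.pos) ∧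
        (v ∈ truth Sig' A → ∃ β < rank (truth Sig' A) u, v ∉ stage (truth Sig' A) β) := by
      by_contra! hc
      exact hA ⟨d, hd, hc⟩
    by_cases hv0 : v ∈ truth Sig' A
    · obtain ⟨β, hβ, hvβ⟩ := hvA hv0
      refine ⟨1, v, _, rfl, ⟨rfl, hv v hv', ?_⟩, .inr (.inr (.inr
        ⟨A, rfl, (rank_le hvβ).trans_lt hβ⟩))⟩
      simpa using fun h => hvβ (h β)
    · exact ⟨0, v, _, rfl, ⟨rfl, hv v hv', by simpa using hv0⟩, .inr (.inr (.inl ⟨⟨_, rfl⟩, rfl⟩))⟩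

end Point

/-! ### Infinite descent along a refuted branch -/

/-- A node of a proof together with a point refuting its sequent. -/
structure RefutedNode (π : InfProof) (Sig : Set Fm) where
  address : List ℕ
  inference : Inference
  label_eq : π.label address = some inference
  point : Point Sig
  refutes : point.Refutes inference.concl

theorem RefutedNode.exists_next {π : InfProof} {Sig : Set Fm} (s : RefutedNode π Sig) :
    ∃ (t : RefutedNode π Sig) (i : ℕ), t.address = s.address ++ [i] ∧
      ((t.point = s.point ∧ ∀ D, ¬ s.inference.IsBoxPlus D) ∨ s.inference.IsBox ∨ (∃ D, s.inference.IsBoxPlus D) ∧ i = 0 ∨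
        ∃ A, s.inference.IsBoxPlus (Fm.boxPlus A) ∧
          Point.rank (Point.truth Sig A) t.point < Point.rank (Point.truth Sig A) s.point) := by
  obtain ⟨i, v, S, hS, hv, h⟩ := Point.exists_refutes_premise s.refutes
  have hstep := π.step s.address i
  rw [s.label_eq, Option.bind_some, hS] at hstep
  obtain ⟨r, hr, rfl⟩ := Option.map_eq_some_iff.mp hstep
  exact ⟨⟨s.address ++ [i], r, hr, v, hv⟩, i, rfl, h⟩

theorem InfProof.not_refutes_root (π : InfProof) {Sig : Set Fm} (u : Point Sig) :
    ¬ u.Refutes π.root := by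
  intro hu
  obtain ⟨r₀, hr₀⟩ := Option.isSome_iff_exists.mp π.root_isSome
  have hroot : r₀.concl = π.root := by simp [InfProof.root, hr₀]
  choose next dir haddr hnext using fun s : RefutedNode π Sig => s.exists_next
  let s : ℕ → RefutedNode π Sig := fun n => next^[n] ⟨[], r₀, hr₀, u, hroot ▸ hu⟩
  have hs : ∀ n, s (n + 1) = next (s n) := fun n => Function.iterate_succ_apply' _ _ _
  let f : ℕ → ℕ := fun n => dir (s n)
  have hb : ∀ n, (s n).address = branchNode f n := by
    intro n
    induction n with
    | zero => rfl
    | succ n ih => rw [hs, haddr, ih, branchNode]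
  have hl : ∀ n, π.label (branchNode f n) = some (s n).inference := fun n =>
    hb n ▸ (s n).label_eq
  obtain ⟨N, C, h1, h2, h3, h4⟩ := π.progress f fun n => by simp [hl]
  obtain ⟨A, rfl⟩ : ∃ A, C = Fm.boxPlus A := by
    obtain ⟨n, hn, r, hr, ⟨D, hD⟩, -⟩ := h2 N le_rfl
    have := h1 n hn r hr D hD
    subst this
    cases r <;> simp only [Inference.IsBoxPlus] at hD
    exact ⟨_, hD⟩
  -- All applications of `(□⁺)` in the tail share the principal formula `□⁺A`, so a single rank
  -- function measures the whole tail.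
  let g : ℕ → Ordinal := fun n => Point.rank (Point.truth Sig A) (s n).point
  have hg : ∀ n ≥ N, (g (n + 1) = g n ∧ ∀ D, ¬ (s n).inference.IsBoxPlus D) ∨
      g (n + 1) < g n := by
    intro n hn
    rcases hnext (s n) with h | h | ⟨hD, h0⟩ | ⟨B, hB, h⟩
    · exact .inl ⟨by simp only [g, hs, h.1], h.2⟩
    · exact (h4 n hn _ (hl n) h).elim
    · exact (h3 n hn _ (hl n) hD h0).elim
    · obtain rfl := Fm.boxPlus.inj (h1 n hn _ (hl n) _ hB)
      exact .inr (by simpa only [g, hs] using h)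
  have hanti : Antitone fun k => g (N + k) := antitone_nat_of_succ_le fun k =>
    (hg (N + k) (by omega)).elim (fun h => h.1.le) le_of_lt
  -- After the minimal rank is attained, a further application of `(□⁺)` would push the rank below
  -- it.
  obtain ⟨_, ⟨k, rfl⟩, hk⟩ := wellFounded_lt.has_min (Set.range fun k => g (N + k))
    (Set.range_nonempty _)
  obtain ⟨n, hn, r, hr, ⟨D, hD⟩, -⟩ := h2 (N + k) (by omega)
  obtain rfl : (s n).inference = r := by simpa [hl] using hr
  obtain ⟨m, rfl⟩ := Nat.exists_eq_add_of_le hn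
  rcases hg (N + k + m) (by omega) with h | h
  · exact h.2 D hD
  · refine hk (g (N + k + m + 1)) ⟨k + m + 1, by simp only [add_assoc]⟩ ?_
    exact h.trans_le (by simpa only [add_assoc] using hanti (Nat.le_add_right k m))

end KPlus

theorem mainTheorem1 (S : KPlus.Sequent) (h : KPlus.ProvableWithCut S) :
    ∃ π : KPlus.InfProof, π.root = S ∧ π.Slim ∧ π.CutFree := by
  obtain ⟨π, rfl⟩ := h
  by_contra hn
  obtain ⟨u, hu, hu'⟩ := KPlus.Point.exists_extends (Sig := π.root.Sig) hn
  exact π.not_refutes_root u ⟨rfl, fun A hA => (KPlus.Point.truth_lemma A u).1 (hu A hA),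
    fun A hA => (KPlus.Point.truth_lemma A u).2 (hu' A hA)⟩
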